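/- Let $k$ be a field and let $P$ be a nonempty finite graded poset with rank function $r_P : P \to \mathbb{N}$, i.e. $r_P(p)=1$ for every minimal element $p$, and $r_P(q)=r_P(p)+1$ whenever $q$ covers $p$. Let $r=\max\{r_P(p) : p\in P\}$, let $\max(P)$ be the set of maximal elements of $P$, and let $s=\min\{r_P(p) : p\in\max(P)\}$. Let $\mathcal{F}(P)\subseteq k[x_p : p\in P]$ be the flag ideal of $P$, generated by the monomials $x_C=\prod_{p\in C}x_p$ where $C$ runs over the maximal chains of $P$. For $A\subseteq P$, regarded as a squarefree multidegree, put $A_i=\{p\in A : r_P(p)=i\}$, and let $B_i=A_i\setminus\max(P)$ for $1<i<r$, $B_1=A_1$ and $B_r=A_r$. Let $\beta_{j,A}$ be the number of basis elements of multidegree $A$ in homological degree $j$ of a minimal $\mathbb{N}^P$-graded free resolution $\cdots\to F_1\to F_0\to\mathcal{F}(P)\to 0$. We say that $A$ appears in the first linear strand if $\beta_{j,A}\neq 0$ for some $j\ge 0$ with $|A|=j+s$. Proposition. For every $A\subseteq P$, the multidegree $A$ appears in the first linear strand of the minimal free resolution of $\mathcal{F}(P)$ if and only if the following three conditions hold.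 1. Every element of $A$ has rank in $\{1,\dots,s\}$, and $A_s\subseteq\max(P)$. 2. $A_i\neq\emptyset$ for all $1\le i\le s$. 3. For all $1\le i\le s-1$, the Hasse diagram of the induced subposet of $P$ on $B_i\cup A_{i+1}$ is the complete bipartite graph with parts $B_i$ and $A_{i+1}$. -/

import Mathlib

/-! ### Rank functions and flag ideals of posets -/

/-- A rank function on a poset: minimal elements have rank `1`, and the rank goes up by one along
every cover relation. A poset is graded if it has a rank function. -/
structure IsPosetRankFunction {P : Type*} [PartialOrder P] (rk : P → ℕ) : Prop where
  rank_of_isMin : ∀ p : P, IsMin p → rk p = 1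
  rank_of_covBy : ∀ p q : P, p ⋖ q → rk q = rk p + 1

/-- The ideal of maximal flags: it is generated by the squarefree monomials `x_C`, where `C` runs
over the maximal chains of the poset. -/
noncomputable def flagIdeal (k : Type*) [Field k] (P : Type*) [PartialOrder P] :
    Ideal (MvPolynomial P k) :=
  Ideal.span {m | ∃ C : Finset P, IsMaxChain (· ≤ ·) (C : Set P) ∧
    m = ∏ p ∈ C, (MvPolynomial.X p : MvPolynomial P k)}

/-! ### Minimal multigraded free resolutions -/

/-- A minimal multigraded free resolution
`⋯ → F₂ → F₁ → F₀ → I → 0` of an ideal `I` of the polynomial ring `R = k[x_σ]`.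
The free module `F_j = R ^ (rank j)` is graded by `σ →₀ ℕ`, its `b`-th basis vector having the
multidegree `deg j b`; all maps preserve multidegrees, the augmented complex is exact, and
`d j` maps `F_{j+1}` into `𝔪 F_j`, where `𝔪` is the ideal generated by the variables. -/
structure MinimalMultigradedFreeResolution {k σ : Type*} [Field k]
    (I : Ideal (MvPolynomial σ k)) where
  /-- The rank of the `j`-th free module. -/
  rank : ℕ → ℕ
  /-- The multidegrees of the basis vectors. -/
  deg : (j : ℕ) → Fin (rank j) → (σ →₀ ℕ)
  /-- The differential `F_{j+1} → F_j`. -/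
  d : (j : ℕ) → (Fin (rank (j + 1)) → MvPolynomial σ k) →ₗ[MvPolynomial σ k]
    (Fin (rank j) → MvPolynomial σ k)
  /-- The augmentation `F_0 → R`, with image `I`. -/
  ε : (Fin (rank 0) → MvPolynomial σ k) →ₗ[MvPolynomial σ k] MvPolynomial σ k
  range_ε : LinearMap.range ε = I
  exact_ε : Function.Exact (d 0) ε
  exact_d : ∀ j, Function.Exact (d (j + 1)) (d j)
  -- The `b`-th basis vector goes to an element of multidegree `deg j b`.
  ε_homogeneous : ∀ b, ∀ m ∈ (ε (Pi.single b 1)).support, m = deg 0 b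
  d_homogeneous : ∀ j b a, ∀ m ∈ (d j (Pi.single b 1) a).support, m + deg j a = deg (j + 1) b
  minimal : ∀ j v a, d j v a ∈ Ideal.span (Set.range (MvPolynomial.X (R := k) (σ := σ)))

namespace MinimalMultigradedFreeResolution

variable {k σ : Type*} [Field k] {I : Ideal (MvPolynomial σ k)}

/-- The multigraded Betti number `β_{j,α}`: the number of basis vectors of multidegree `α` in
homological degree `j`. -/
noncomputable def betti (F : MinimalMultigradedFreeResolution I) (j : ℕ) (α : σ →₀ ℕ) : ℕ :=
  Nat.card {b : Fin (F.rank j) // F.deg j b = α}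

/-- The multidegree `α` appears in the `s`-linear strand: `β_{j,α} ≠ 0` for some `j` with
`|α| = j + s`. -/
def AppearsInLinearStrand (F : MinimalMultigradedFreeResolution I) (s : ℕ) (α : σ →₀ ℕ) : Prop :=
  ∃ j : ℕ, Finsupp.degree α = j + s ∧ F.betti j α ≠ 0

end MinimalMultigradedFreeResolution

/-- The squarefree multidegree of a finite set of variables. -/
noncomputable def squarefreeMultidegree {P : Type*} (A : Finset P) : P →₀ ℕ :=
  ∑ p ∈ A, Finsupp.single p 1

/-! ### Rank levels of a multidegree -/

section Levels

variable {P : Type*} [PartialOrder P]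

/-- The rank `max {rk p | p ∈ P}` of a finite graded poset. -/
def posetRank [Fintype P] (rk : P → ℕ) : ℕ := Finset.univ.sup rk

/-- `A_i`: the elements of `A` of rank `i`. -/
def level (rk : P → ℕ) (A : Finset P) (i : ℕ) : Set P := {p | p ∈ A ∧ rk p = i}

/-- `B_i`: it is `A_i \ max(P)` for `1 < i < r` and `A_i` for `i = 1` and `i = r`, where `r` is the
rank of `P`. -/
def nonmaxLevel [Fintype P] (rk : P → ℕ) (A : Finset P) (i : ℕ) : Set P :=
  {p | p ∈ level rk A i ∧ (i = 1 ∨ i = posetRank rk ∨ ¬ IsMax p)}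

/-- The Hasse diagram of the induced subposet on `S ∪ T` is the complete bipartite graph with
parts `S` and `T`. -/
def IsCompleteBipartiteSubposet (S T : Set P) : Prop :=
  Disjoint S T ∧ ∀ x y : ↥(S ∪ T), (SimpleGraph.hasse ↥(S ∪ T)).Adj x y ↔
    ((x : P) ∈ S ∧ (y : P) ∈ T) ∨ ((x : P) ∈ T ∧ (y : P) ∈ S)

end Levels

/-! ### Maximal chains of finite graded posets -/

namespace IsPosetRankFunction

variable {P : Type*} [PartialOrder P] [Finite P] {rk : P → ℕ}

/-! The three conditions amount to `IsCompleteMultilevel`. A maximal chain has one element of each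
rank from 1 to its length and ends at a maximal element, so generators of the flag ideal have degree
at least `s`. Hence on scalar vectors of degree `j + 1 + s` the differential of `F` is linear: `d v
= ∑ p, x_p • contract p v`. Minimality and exactness make these contractions jointly injective, and
`d ∘ d = 0` makes contractions by distinct variables anticommute.

If a basis vector has multidegree `A` in the strand, contract it down to `F_0`. The sets `C ⊆ A`
where a nonzero vector survives are maximal chains of length `s`. Contracting everything outside `C
∪ {a}` leaves a linear syzygy in `F_1` whose augmented contractions sum to zero, so some other term
is nonzero and `a` can be exchanged for some `p ∈ C` (`reaches_exchange`). Both chains have one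
element per rank, so `p` and `a` have equal rank. Thus any element of `A` can replace the one of its
rank in any such chain, which makes elements of different ranks comparable
(`isCompleteMultilevel_of_exchange`).

Conversely, vectors `v_A` with `contract p v_A = ± v_(A \ p)` are built by induction on `j`, with
signs from a linear order refining the rank and `v_A = 0` when `A` is not complete. The prescribed
images are cycles by the simplicial sign rule, hence lift. If `|A| > s`, two elements share a rank;
removing one keeps `A` complete, so `v_A ≠ 0` by induction, and a basis vector of degree `A` exists.
-/

theorem lt_of_lt (hrk : IsPosetRankFunction rk) {x y : P} (h : x < y) : rk x < rk y := by
  induction x using WellFoundedGT.induction with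
  | ind x ih =>
    obtain ⟨z, hz, hzy⟩ := exists_covBy_le_of_lt h
    have h1 := hrk.rank_of_covBy _ _ hz
    rcases hzy.eq_or_lt with rfl | hlt
    · omega
    · have := ih z hz.lt hlt
      omega

theorem le_of_le (hrk : IsPosetRankFunction rk) {x y : P} (h : x ≤ y) : rk x ≤ rk y := by
  rcases h.eq_or_lt with rfl | h
  · exact le_rfl
  · exact (hrk.lt_of_lt h).le

theorem one_le (hrk : IsPosetRankFunction rk) (x : P) : 1 ≤ rk x := by
  by_cases hx : IsMin x
  · exact (hrk.rank_of_isMin x hx).ge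
  · obtain ⟨y, hy⟩ := not_isMin_iff.1 hx
    have := hrk.lt_of_lt hy
    omega

theorem injOn_chain (hrk : IsPosetRankFunction rk) {C : Set P} (hC : IsChain (· ≤ ·) C) :
    Set.InjOn rk C := by
  intro x hx y hy hxy
  by_contra hne
  rcases hC hx hy hne with h | h
  · have := hrk.lt_of_lt (lt_of_le_of_ne h hne)
    omega
  · have := hrk.lt_of_lt (lt_of_le_of_ne h (Ne.symm hne))
    omega

end IsPosetRankFunction

theorem IsMaxChain.mem_of_forall_comparable {P : Type*} [PartialOrder P] {C : Set P}
    (hC : IsMaxChain (· ≤ ·) C) {z : P} (hz : ∀ c ∈ C, z ≤ c ∨ c ≤ z) : z ∈ C := by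
  have h : IsChain (· ≤ ·) (insert z C) := hC.1.insert fun c hc _ => hz c hc
  rw [hC.2 h (Set.subset_insert _ _)]
  exact Set.mem_insert _ _

namespace IsPosetRankFunction

variable {P : Type*} [PartialOrder P] [Finite P] {rk : P → ℕ}

/-- Below an element of rank at least two of a maximal chain, the next rank occurs. -/
theorem exists_pred_mem_maxChain (hrk : IsPosetRankFunction rk) {C : Finset P}
    (hC : IsMaxChain (· ≤ ·) (C : Set P)) {x : P} (hx : x ∈ C) (h : 1 < rk x) :
    ∃ y ∈ C, rk y + 1 = rk x := by
  classical
  have hne : (C.filter (· < x)).Nonempty := by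
    by_contra hne
    rw [Finset.not_nonempty_iff_eq_empty, Finset.filter_eq_empty_iff] at hne
    -- If `x` is least in `C`, anything below `x` is comparable with all of `C`, hence lies in `C`.
    -- So `x` is minimal, of rank 1.
    have hmin : ∀ c ∈ C, x ≤ c := by
      intro c hc
      rcases hC.1.total hx hc with h | h
      · exact h
      · exact (eq_of_le_of_not_lt h (hne hc)).ge
    have : IsMin x := by
      intro z hz
      exact hmin z (hC.mem_of_forall_comparable fun c hc => Or.inl (hz.trans (hmin c hc)))
    have := hrk.rank_of_isMin x this
    omega
  obtain ⟨y, hy, hmax⟩ := Finset.exists_max_image _ rk hne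
  rw [Finset.mem_filter] at hy
  -- The highest-ranked `y ∈ C` below `x` is covered by `x`: an element strictly between would be
  -- comparable with all of `C`, so it would lie in `C` with larger rank.
  refine ⟨y, hy.1, (hrk.rank_of_covBy y x ⟨hy.2, fun z hyz hzx => ?_⟩).symm⟩
  have hz : z ∈ C := by
    refine hC.mem_of_forall_comparable fun c hc => ?_
    rcases hC.1.total hc hx with h | h
    · rcases h.eq_or_lt with rfl | hlt
      · exact Or.inl hzx.le
      · have h1 := hmax c (Finset.mem_filter.2 ⟨hc, hlt⟩)
        rcases hC.1.total hc hy.1 with h2 | h2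
        · exact Or.inr (h2.trans hyz.le)
        · rcases h2.eq_or_lt with rfl | h3
          · exact Or.inr hyz.le
          · have := hrk.lt_of_lt h3
            omega
    · exact Or.inl (hzx.le.trans h)
  have h1 := hmax z (Finset.mem_filter.2 ⟨hz, hzx⟩)
  have := hrk.lt_of_lt hyz
  omega

/-- A maximal chain with `n` elements has exactly one element of each rank `1, …, n`, and its last
element is a maximal element. -/
theorem maxChain_spec [Nonempty P] (hrk : IsPosetRankFunction rk) {C : Finset P}
    (hC : IsMaxChain (· ≤ ·) (C : Set P)) :
    ∃ t ∈ C, IsMax t ∧ rk t = C.card ∧ C.image rk = Finset.Icc 1 C.card := by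
  have hne : C.Nonempty := by
    by_contra hne
    rw [Finset.not_nonempty_iff_eq_empty] at hne
    have := hC.mem_of_forall_comparable (z := Classical.arbitrary P) (by simp [hne])
    simp [hne] at this
  obtain ⟨t, ht, hmax⟩ := Finset.exists_max_image C rk hne
  have htop : ∀ c ∈ C, c ≤ t := by
    intro c hc
    rcases hC.1.total hc ht with h | h
    · exact h
    · rcases h.eq_or_lt with h | h
      · exact h.ge
      · have := hrk.lt_of_lt h
        have := hmax c hc
        omega
  have htm : IsMax t := fun z hz =>
    htop z (hC.mem_of_forall_comparable fun c hc => Or.inr ((htop c hc).trans hz))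
  have key : ∀ i, i < rk t → ∃ c ∈ C, rk c + i = rk t := by
    intro i
    induction i with
    | zero => exact fun _ => ⟨t, ht, by simp⟩
    | succ i ih =>
      intro hi
      obtain ⟨c, hc, hci⟩ := ih (by omega)
      obtain ⟨y, hy, hyc⟩ := hrk.exists_pred_mem_maxChain hC hc (by omega)
      exact ⟨y, hy, by omega⟩
  have himg : C.image rk = Finset.Icc 1 (rk t) := by
    ext i
    simp only [Finset.mem_image, Finset.mem_Icc]
    constructor
    · rintro ⟨c, hc, rfl⟩
      exact ⟨hrk.one_le c, hmax c hc⟩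
    · rintro ⟨h1, h2⟩
      obtain ⟨c, hc, hci⟩ := key (rk t - i) (by omega)
      exact ⟨c, hc, by omega⟩
  have hcard : C.card = rk t := by
    rw [← Finset.card_image_of_injOn (hrk.injOn_chain hC.1), himg]
    simp
  exact ⟨t, ht, htm, hcard.symm, hcard ▸ himg⟩

end IsPosetRankFunction

/-! ### Complete multilevel sets -/

/-- The combinatorial description of a squarefree multidegree in the linear strand: all the ranks
`1, …, s` and no others occur, elements of consecutive ranks are comparable, and the elements of
rank `s` are maximal. -/
structure IsCompleteMultilevel {P : Type*} [PartialOrder P] (rk : P → ℕ) (s : ℕ)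
    (A : Finset P) : Prop where
  rank_le : ∀ p ∈ A, rk p ≤ s
  exists_rank : ∀ i, 1 ≤ i → i ≤ s → ∃ p ∈ A, rk p = i
  isMax : ∀ p ∈ A, rk p = s → IsMax p
  lt : ∀ p ∈ A, ∀ q ∈ A, rk q = rk p + 1 → p < q

namespace IsCompleteMultilevel

variable {P : Type*} [PartialOrder P] {rk : P → ℕ} {s : ℕ} {A : Finset P}

theorem erase [DecidableEq P] (hA : IsCompleteMultilevel rk s A) {p q : P} (hq : q ∈ A)
    (hpq : p ≠ q) (h : rk p = rk q) : IsCompleteMultilevel rk s (A.erase p) where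
  rank_le x hx := hA.rank_le x (Finset.mem_of_mem_erase hx)
  exists_rank i h1 h2 := by
    obtain ⟨x, hx, rfl⟩ := hA.exists_rank i h1 h2
    by_cases hxp : x = p
    · exact ⟨q, Finset.mem_erase.2 ⟨hpq.symm, hq⟩, by rw [hxp, h]⟩
    · exact ⟨x, Finset.mem_erase.2 ⟨hxp, hx⟩, rfl⟩
  isMax x hx := hA.isMax x (Finset.mem_of_mem_erase hx)
  lt x hx y hy := hA.lt x (Finset.mem_of_mem_erase hx) y (Finset.mem_of_mem_erase hy)

theorem lt_of_rank_lt (hA : IsCompleteMultilevel rk s A) {p q : P} (hp : p ∈ A) (hq : q ∈ A)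
    (h : rk p < rk q) : p < q := by
  obtain ⟨d, hd⟩ : ∃ d, rk q = rk p + 1 + d := Nat.exists_eq_add_of_le h
  induction d generalizing q with
  | zero => exact hA.lt p hp q hq hd
  | succ d ih =>
    obtain ⟨x, hx, hxr⟩ := hA.exists_rank (rk p + 1 + d) (by omega)
      (by have := hA.rank_le q hq; omega)
    exact (ih hx (by omega) hxr).trans (hA.lt x hx q hq (by omega))

variable [Finite P]

theorem image_rank (hrk : IsPosetRankFunction rk) (hA : IsCompleteMultilevel rk s A) :
    A.image rk = Finset.Icc 1 s := by
  ext i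
  simp only [Finset.mem_image, Finset.mem_Icc]
  constructor
  · rintro ⟨c, hc, rfl⟩
    exact ⟨hrk.one_le c, hA.rank_le c hc⟩
  · rintro ⟨h1, h2⟩
    exact hA.exists_rank i h1 h2

/-- With `s` elements there is exactly one per rank. The chain cannot be enlarged: its top is
maximal in `P`, so a further element would repeat a rank. -/
theorem isMaxChain (hrk : IsPosetRankFunction rk) (hs : 1 ≤ s)
    (hA : IsCompleteMultilevel rk s A) (hcard : A.card = s) :
    IsMaxChain (· ≤ ·) (A : Set P) := by
  have hinj : Set.InjOn rk A := by
    rw [← Finset.card_image_iff, hA.image_rank hrk]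
    simp [hcard]
  refine ⟨fun x hx y hy hxy => ?_, fun T hT hAT => hAT.antisymm fun z hz => ?_⟩
  · rcases lt_trichotomy (rk x) (rk y) with h | h | h
    · exact Or.inl (hA.lt_of_rank_lt hx hy h).le
    · exact absurd (hinj hx hy h) hxy
    · exact Or.inr (hA.lt_of_rank_lt hy hx h).le
  · obtain ⟨t, ht, hts⟩ := hA.exists_rank s hs le_rfl
    have hzs : rk z ≤ s := by
      rcases hT.total hz (hAT ht) with h | h
      · exact (hrk.le_of_le h).trans hts.le
      · exact (hrk.le_of_le (hA.isMax t ht hts h)).trans hts.le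
    obtain ⟨c, hc, hcz⟩ := hA.exists_rank (rk z) (hrk.one_le z) hzs
    rw [← hrk.injOn_chain hT (hAT hc) hz hcz]
    exact hc

end IsCompleteMultilevel

/-- The three conditions on levels, restated elementwise. -/
theorem isCompleteMultilevel_iff {P : Type*} [PartialOrder P] [Fintype P] {rk : P → ℕ}
    (hrk : IsPosetRankFunction rk) {s : ℕ} (hs : IsLeast (rk '' {p : P | IsMax p}) s)
    (A : Finset P) :
    IsCompleteMultilevel rk s A ↔
      ((∀ p ∈ A, 1 ≤ rk p ∧ rk p ≤ s) ∧ level rk A s ⊆ {p : P | IsMax p}) ∧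
      (∀ i, 1 ≤ i → i ≤ s → (level rk A i).Nonempty) ∧
      (∀ i, 1 ≤ i → i + 1 ≤ s →
        IsCompleteBipartiteSubposet (nonmaxLevel rk A i) (level rk A (i + 1))) := by
  -- By minimality of `s` no element of rank below `s` is maximal, so nothing is removed from these
  -- levels.
  have hB : ∀ i, i + 1 ≤ s → nonmaxLevel rk A i = level rk A i := by
    intro i hi
    refine Set.Subset.antisymm (fun p hp => hp.1) fun p hp => ⟨hp, Or.inr (Or.inr fun hm => ?_)⟩
    have := hs.2 ⟨p, hm, rfl⟩
    have := hp.2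
    omega
  -- No rank lies strictly between `i` and `i + 1`, so every strict comparability in this subposet
  -- is a cover.
  have hcov : ∀ i, ∀ x y : ↥(level rk A i ∪ level rk A (i + 1)),
      (x : P) < y → x ⋖ y ∧ (x : P) ∈ level rk A i ∧ (y : P) ∈ level rk A (i + 1) := by
    intro i
    have hr : ∀ x : ↥(level rk A i ∪ level rk A (i + 1)), rk x = i ∨ rk x = i + 1 :=
      fun x => x.2.imp (fun h => h.2) fun h => h.2
    intro x y hxy
    have h0 := hrk.lt_of_lt hxy
    have hx := hr x
    have hy := hr y
    refine ⟨⟨hxy, fun z hxz hzy => ?_⟩, x.2.resolve_right fun h => ?_, y.2.resolve_left fun h => ?_⟩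
    · have h1 := hrk.lt_of_lt (show (x : P) < z from hxz)
      have h2 := hrk.lt_of_lt (show (z : P) < y from hzy)
      omega
    · have := h.2
      omega
    · have := h.2
      omega
  constructor
  · intro hA
    refine ⟨⟨fun p hp => ⟨hrk.one_le p, hA.rank_le p hp⟩, fun p hp => hA.isMax p hp.1 hp.2⟩,
      fun i h1 h2 => ?_, fun i h1 h2 => ?_⟩
    · obtain ⟨p, hp, h⟩ := hA.exists_rank i h1 h2
      exact ⟨p, hp, h⟩
    · rw [hB i h2]
      refine ⟨Set.disjoint_left.2 fun p hp hq => ?_, fun x y => ?_⟩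
      · have := hp.2
        have := hq.2
        omega
      · rw [SimpleGraph.hasse_adj]
        constructor
        · rintro (h | h)
          · exact Or.inl (hcov i x y h.lt).2
          · exact Or.inr (hcov i y x h.lt).2.symm
        · rintro (⟨h, h'⟩ | ⟨h, h'⟩)
          · exact Or.inl (hcov i x y (hA.lt x h.1 y h'.1 (by rw [h.2, h'.2]))).1
          · exact Or.inr (hcov i y x (hA.lt y h'.1 x h.1 (by rw [h.2, h'.2]))).1
  · rintro ⟨⟨h1, h2⟩, h3, h4⟩
    refine ⟨fun p hp => (h1 p hp).2, fun i hi hi' => ?_, fun p hp h => h2 ⟨hp, h⟩,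
      fun p hp q hq hpq => ?_⟩
    · obtain ⟨p, hp, h⟩ := h3 i hi hi'
      exact ⟨p, hp, h⟩
    · have hle : rk p + 1 ≤ s := hpq ▸ (h1 q hq).2
      have h5 := h4 (rk p) (h1 p hp).1 hle
      rw [hB _ hle] at h5
      have h6 := (h5.2 ⟨p, Or.inl ⟨hp, rfl⟩⟩ ⟨q, Or.inr ⟨hq, hpq⟩⟩).2
        (Or.inl ⟨⟨hp, rfl⟩, hq, hpq⟩)
      rw [SimpleGraph.hasse_adj] at h6
      rcases h6 with h | h
      · exact h.lt
      · have h7 := hrk.lt_of_lt (show q < p from h.lt)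
        omega

/-- A nonempty family of maximal chains with `s` elements in `A` having the exchange property
forces `A` to be a complete multilevel set. -/
theorem isCompleteMultilevel_of_exchange {P : Type*} [PartialOrder P] [Finite P] [Nonempty P]
    [DecidableEq P] {rk : P → ℕ} (hrk : IsPosetRankFunction rk) {s : ℕ} {A : Finset P}
    {S : Finset P → Prop}
    (hS : ∀ C, S C → C ⊆ A ∧ C.card = s ∧ IsMaxChain (· ≤ ·) (C : Set P))
    (hex : ∀ C, S C → ∀ a ∈ A, a ∉ C → ∃ p ∈ C, S ((insert a C).erase p))
    (hne : ∃ C, S C) : IsCompleteMultilevel rk s A := by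
  obtain ⟨C₀, hC₀⟩ := hne
  have hrank : ∀ C, S C → C.image rk = Finset.Icc 1 s ∧ ∀ p ∈ C, rk p = s → IsMax p := by
    intro C hC
    obtain ⟨hCA, hcard, hmax⟩ := hS C hC
    obtain ⟨t, ht, htm, hts, himg⟩ := hrk.maxChain_spec hmax
    rw [hcard] at hts himg
    refine ⟨himg, fun p hp hps => ?_⟩
    rw [hrk.injOn_chain hmax.1 hp ht (hps.trans hts.symm)]
    exact htm
  -- The exchanged chain still has every rank once, so the removed element has the rank of `a` and
  -- all elements of other ranks survive.
  have hcover : ∀ C, S C → ∀ a ∈ A, ∃ C', S C' ∧ a ∈ C' ∧ ∀ x ∈ C, rk x ≠ rk a → x ∈ C' := by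
    intro C hC a ha
    by_cases haC : a ∈ C
    · exact ⟨C, hC, haC, fun x hx _ => hx⟩
    · obtain ⟨p, hp, hC'⟩ := hex C hC a ha haC
      have hpa : p ≠ a := fun h => haC (h ▸ hp)
      refine ⟨_, hC', by simp [hpa.symm], fun x hx hxa => ?_⟩
      have hmem : rk p ∈ ((insert a C).erase p).image rk := by
        rw [(hrank _ hC').1, ← (hrank _ hC).1]
        exact Finset.mem_image_of_mem _ hp
      obtain ⟨y, hy, hyp⟩ := Finset.mem_image.1 hmem
      rw [Finset.mem_erase, Finset.mem_insert] at hy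
      have hya : y = a := by
        refine hy.2.resolve_right fun hyC => hy.1 ?_
        exact hrk.injOn_chain (hS C hC).2.2.1 hyC hp hyp
      subst hya
      refine Finset.mem_erase.2 ⟨?_, Finset.mem_insert_of_mem hx⟩
      rintro rfl
      exact hxa hyp.symm
  refine ⟨fun p hp => ?_, fun i h1 h2 => ?_, fun p hp h => ?_, fun p hp q hq h => ?_⟩
  · obtain ⟨C, hC, hpC, -⟩ := hcover C₀ hC₀ p hp
    have := Finset.mem_image_of_mem rk hpC
    rw [(hrank C hC).1, Finset.mem_Icc] at this
    exact this.2
  · have : i ∈ C₀.image rk := by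
      rw [(hrank C₀ hC₀).1, Finset.mem_Icc]
      exact ⟨h1, h2⟩
    obtain ⟨p, hp, h⟩ := Finset.mem_image.1 this
    exact ⟨p, (hS C₀ hC₀).1 hp, h⟩
  · obtain ⟨C, hC, hpC, -⟩ := hcover C₀ hC₀ p hp
    exact (hrank C hC).2 p hpC h
  · obtain ⟨C, hC, hpC, -⟩ := hcover C₀ hC₀ p hp
    -- Exchanging `q` in keeps `p`, whose rank differs, so both lie in one chain.
    obtain ⟨C', hC', hqC, hC''⟩ := hcover C hC q hq
    have hpq : p ≠ q := by
      rintro rfl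
      omega
    rcases (hS C' hC').2.2.1 (hC'' p hpC (by omega)) hqC hpq with h' | h'
    · exact lt_of_le_of_ne h' hpq
    · have := hrk.le_of_le h'
      omega

/-! ### Multidegrees -/

theorem squarefreeMultidegree_apply {P : Type*} [DecidableEq P] (A : Finset P) (p : P) :
    squarefreeMultidegree A p = if p ∈ A then 1 else 0 := by
  simp [squarefreeMultidegree, Finsupp.finsetSum_apply, Finsupp.single_apply]

theorem degree_squarefreeMultidegree {P : Type*} (A : Finset P) :
    (squarefreeMultidegree A).degree = A.card := by
  simp [squarefreeMultidegree]

theorem squarefreeMultidegree_le_iff {P : Type*} {A B : Finset P} :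
    squarefreeMultidegree A ≤ squarefreeMultidegree B ↔ A ⊆ B := by
  classical
  simp only [Finsupp.le_def, squarefreeMultidegree_apply]
  refine ⟨fun h p hp => ?_, fun h p => ?_⟩
  · by_contra hp'
    have := h p
    simp [hp, hp'] at this
  · by_cases hp : p ∈ A
    · simp [hp, h hp]
    · simp [hp]

theorem single_add_squarefreeMultidegree_erase {P : Type*} [DecidableEq P] {A : Finset P} {p : P}
    (hp : p ∈ A) :
    Finsupp.single p 1 + squarefreeMultidegree (A.erase p) = squarefreeMultidegree A :=
  Finset.add_sum_erase A (fun p => Finsupp.single p 1) hp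

theorem Finsupp.degree_le_degree_of_le {σ : Type*} {m n : σ →₀ ℕ} (h : m ≤ n) :
    m.degree ≤ n.degree := by
  obtain ⟨d, rfl⟩ := le_iff_exists_add.1 h
  simp

theorem Finsupp.eq_of_le_of_degree_le {σ : Type*} {m n : σ →₀ ℕ} (h : m ≤ n)
    (h' : n.degree ≤ m.degree) : m = n := by
  obtain ⟨d, rfl⟩ := le_iff_exists_add.1 h
  rw [map_add] at h'
  have : d = 0 := (Finsupp.degree_eq_zero_iff d).1 (by omega)
  simp [this]

theorem Finsupp.exists_single_add_of_ne_zero {σ : Type*} {m : σ →₀ ℕ} (h : m ≠ 0) :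
    ∃ p d, m = Finsupp.single p 1 + d := by
  obtain ⟨p, hp⟩ := Finsupp.ne_iff.1 h
  refine ⟨p, m - Finsupp.single p 1, (add_tsub_cancel_of_le ?_).symm⟩
  rw [Finsupp.single_le_iff]
  simp at hp
  omega

theorem Finsupp.eq_single_of_degree_eq_one {σ : Type*} {m : σ →₀ ℕ} (h : m.degree = 1) :
    ∃ p, m = Finsupp.single p 1 := by
  obtain ⟨p, d, rfl⟩ := Finsupp.exists_single_add_of_ne_zero (m := m) (by rintro rfl; simp at h)
  rw [map_add, Finsupp.degree_single] at h
  exact ⟨p, by rw [(Finsupp.degree_eq_zero_iff d).1 (by omega), add_zero]⟩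

/-! ### The flag ideal -/

section FlagIdeal

variable {k : Type*} [Field k] {P : Type*} [PartialOrder P]

theorem mem_flagIdeal_iff {f : MvPolynomial P k} :
    f ∈ flagIdeal k P ↔ ∀ m ∈ f.support, ∃ C : Finset P, IsMaxChain (· ≤ ·) (C : Set P) ∧
      squarefreeMultidegree C ≤ m := by
  have h : flagIdeal k P = Ideal.span ((fun m => MvPolynomial.monomial m (1 : k)) ''
      {m | ∃ C : Finset P, IsMaxChain (· ≤ ·) (C : Set P) ∧ m = squarefreeMultidegree C}) := by
    unfold flagIdeal
    congr 1
    ext f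
    simp only [Set.mem_ofPred_eq, Set.mem_image]
    have hm : ∀ C : Finset P, MvPolynomial.monomial (squarefreeMultidegree C) (1 : k) =
        ∏ p ∈ C, MvPolynomial.X p := fun C => MvPolynomial.monomial_sum_one C _
    constructor
    · rintro ⟨C, hC, rfl⟩
      exact ⟨_, ⟨C, hC, rfl⟩, hm C⟩
    · rintro ⟨_, ⟨C, hC, rfl⟩, rfl⟩
      exact ⟨C, hC, hm C⟩
  rw [h, MvPolynomial.mem_ideal_span_monomial_image]
  refine forall₂_congr fun m _ => ⟨?_, ?_⟩
  · rintro ⟨_, ⟨C, hC, rfl⟩, hle⟩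
    exact ⟨C, hC, hle⟩
  · rintro ⟨C, hC, hle⟩
    exact ⟨_, ⟨C, hC, rfl⟩, hle⟩

end FlagIdeal

/-! ### The linear strand of a resolution -/

theorem MvPolynomial.coeff_single_one_mul {k σ : Type*} [CommSemiring k] {f g : MvPolynomial σ k}
    (hg : MvPolynomial.coeff 0 g = 0) (p : σ) :
    MvPolynomial.coeff (Finsupp.single p 1) (f * g) =
      MvPolynomial.coeff 0 f * MvPolynomial.coeff (Finsupp.single p 1) g := by
  classical
  rw [MvPolynomial.coeff_mul, Finsupp.antidiagonal_single, Finset.sum_map]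
  simp [Finset.Nat.antidiagonal_succ, hg]

theorem MvPolynomial.coeff_zero_eq_zero_of_mem {k σ : Type*} [CommRing k] {f : MvPolynomial σ k}
    (hf : f ∈ Ideal.span (Set.range (MvPolynomial.X (R := k) (σ := σ)))) :
    MvPolynomial.coeff 0 f = 0 := by
  have h : Ideal.span (Set.range (MvPolynomial.X (R := k) (σ := σ))) ≤
      RingHom.ker (MvPolynomial.constantCoeff (R := k) (σ := σ)) := by
    rw [Ideal.span_le]
    rintro _ ⟨p, rfl⟩
    simp [RingHom.mem_ker]
  exact h hf

/-- The coefficient of `x_p x_q` collects exactly these two terms. This extracts anticommutation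
from `d ∘ d = 0`. -/
theorem MvPolynomial.sum_X_mul_X_mul_C_eq_zero {k σ : Type*} [CommRing k] [Fintype σ]
    {w : σ → σ → k}
    (h : ∑ p, ∑ q, (MvPolynomial.X p * MvPolynomial.X q * MvPolynomial.C (w p q) :
      MvPolynomial σ k) = 0) {p q : σ} (hpq : p ≠ q) : w p q + w q p = 0 := by
  classical
  have h1 := congrArg (MvPolynomial.coeff (Finsupp.single p 1 + Finsupp.single q 1)) h
  have h2 : ∀ p' q', MvPolynomial.coeff (Finsupp.single p 1 + Finsupp.single q 1)
      (MvPolynomial.X p' * MvPolynomial.X q' * MvPolynomial.C (w p' q') : MvPolynomial σ k) =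
      (if p' = p ∧ q' = q then w p' q' else 0) + if p' = q ∧ q' = p then w p' q' else 0 := by
    intro p' q'
    have h3 : (MvPolynomial.X p' * MvPolynomial.X q' * MvPolynomial.C (w p' q') :
        MvPolynomial σ k) =
        MvPolynomial.monomial (Finsupp.single p' 1 + Finsupp.single q' 1) (w p' q') := by
      rw [MvPolynomial.X, MvPolynomial.X, MvPolynomial.monomial_mul, mul_comm,
        MvPolynomial.C_mul_monomial]
      simp
    rw [h3, MvPolynomial.coeff_monomial]
    by_cases ha : p' = p ∧ q' = q
    · obtain ⟨rfl, rfl⟩ := ha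
      simp [hpq]
    · by_cases hb : p' = q ∧ q' = p
      · obtain ⟨rfl, rfl⟩ := hb
        simp [hpq, add_comm]
      · rw [if_neg ha, if_neg hb, if_neg, add_zero]
        intro he
        rw [Finsupp.single_add_single_eq_single_add_single one_ne_zero one_ne_zero] at he
        rcases he with h | h | h
        · exact ha h
        · simp_all
        · simp_all
  simp only [MvPolynomial.coeff_sum, h2, Finset.sum_add_distrib, MvPolynomial.coeff_zero] at h1
  simpa [ite_and] using h1

namespace MinimalMultigradedFreeResolution

open MvPolynomial

variable {k σ : Type*} [Field k] {I : Ideal (MvPolynomial σ k)}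
  (F : MinimalMultigradedFreeResolution I)

/-- A vector of scalars, as a vector of constant polynomials. -/
noncomputable def scalarVec {ι : Type*} (v : ι → k) : ι → MvPolynomial σ k := fun i => C (v i)

/-- The coefficient of the variable `p` in the differential, as a map on vectors of scalars. -/
noncomputable def contract (j : ℕ) (p : σ) (v : Fin (F.rank (j + 1)) → k) : Fin (F.rank j) → k :=
  fun a => coeff (Finsupp.single p 1) (F.d j (scalarVec v) a)

/-- The sum of the coefficients of the image under the augmentation. -/
noncomputable def augment (v : Fin (F.rank 0) → k) : k :=
  eval (fun _ => 1) (F.ε (scalarVec v))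

/-- A vector of scalars that only involves basis vectors of multidegree `α`. -/
def IsHomogeneousVec (j : ℕ) (α : σ →₀ ℕ) (v : Fin (F.rank j) → k) : Prop :=
  ∀ b, v b ≠ 0 → F.deg j b = α

theorem scalarVec_zero {ι : Type*} : scalarVec (σ := σ) (0 : ι → k) = 0 := by
  ext; simp [scalarVec]

theorem scalarVec_neg {ι : Type*} (v : ι → k) : scalarVec (σ := σ) (-v) = -scalarVec v := by
  ext; simp [scalarVec]

theorem scalarVec_sub {ι : Type*} (v w : ι → k) :
    scalarVec (σ := σ) (v - w) = scalarVec v - scalarVec w := by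
  ext; simp [scalarVec]

theorem scalarVec_smul {ι : Type*} (c : k) (v : ι → k) :
    scalarVec (σ := σ) (c • v) = (C c : MvPolynomial σ k) • scalarVec v := by
  ext; simp [scalarVec]

theorem scalarVec_single {ι : Type*} [DecidableEq ι] (i : ι) :
    scalarVec (σ := σ) (Pi.single i (1 : k)) = Pi.single i 1 := by
  ext1 a
  by_cases h : a = i
  · subst h; simp [scalarVec]
  · simp [scalarVec, h]

theorem contract_zero (j : ℕ) (p : σ) : F.contract j p 0 = 0 := by
  ext; simp [contract, scalarVec_zero]

theorem contract_neg (j : ℕ) (p : σ) (v) : F.contract j p (-v) = -F.contract j p v := by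
  ext; simp [contract, scalarVec_neg]

theorem contract_sub (j : ℕ) (p : σ) (v w) :
    F.contract j p (v - w) = F.contract j p v - F.contract j p w := by
  ext; simp [contract, scalarVec_sub]

theorem contract_smul (j : ℕ) (p : σ) (c : k) (v) :
    F.contract j p (c • v) = c • F.contract j p v := by
  ext; simp [contract, scalarVec_smul]

theorem augment_smul (c : k) (v) : F.augment (c • v) = c * F.augment v := by
  simp [augment, scalarVec_smul]

theorem augment_zero : F.augment 0 = 0 := by
  simp [augment, scalarVec_zero]

theorem sum_smul_single {n : ℕ} {M : Type*} [AddCommMonoid M] [Module (MvPolynomial σ k) M]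
    (f : (Fin n → MvPolynomial σ k) →ₗ[MvPolynomial σ k] M) (u : Fin n → MvPolynomial σ k) :
    f u = ∑ b, u b • f (Pi.single b 1) := by
  conv_lhs => rw [pi_eq_sum_univ' u]
  simp

theorem d_apply (j : ℕ) (u : Fin (F.rank (j + 1)) → MvPolynomial σ k) (a) :
    F.d j u a = ∑ b, u b * F.d j (Pi.single b 1) a := by
  rw [sum_smul_single (F.d j) u]
  simp

theorem coeff_zero_d (j : ℕ) (u : Fin (F.rank (j + 1)) → MvPolynomial σ k) (a) :
    coeff 0 (F.d j u a) = 0 :=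
  coeff_zero_eq_zero_of_mem (F.minimal j u a)

/-- The linear part of the differential only depends on the constant coefficients. -/
theorem coeff_single_d (j : ℕ) (p : σ) (u : Fin (F.rank (j + 1)) → MvPolynomial σ k) (a) :
    coeff (Finsupp.single p 1) (F.d j u a) = F.contract j p (fun b => coeff 0 (u b)) a := by
  rw [contract, d_apply, d_apply, coeff_sum, coeff_sum]
  refine Finset.sum_congr rfl fun b _ => ?_
  rw [coeff_single_one_mul (F.coeff_zero_d _ _ _), scalarVec, coeff_C_mul]

theorem exists_deg_of_coeff_d_ne_zero {j : ℕ} {v : Fin (F.rank (j + 1)) → k} {a} {m : σ →₀ ℕ}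
    (h : coeff m (F.d j (scalarVec v) a) ≠ 0) : ∃ b, v b ≠ 0 ∧ m + F.deg j a = F.deg (j + 1) b := by
  rw [d_apply, coeff_sum] at h
  obtain ⟨b, -, hb⟩ := Finset.exists_ne_zero_of_sum_ne_zero h
  rw [scalarVec, coeff_C_mul] at hb
  exact ⟨b, left_ne_zero_of_mul hb,
    F.d_homogeneous j b a m (mem_support_iff.2 (right_ne_zero_of_mul hb))⟩

theorem exists_deg_of_coeff_ε_ne_zero {v : Fin (F.rank 0) → k} {m : σ →₀ ℕ}
    (h : coeff m (F.ε (scalarVec v)) ≠ 0) : ∃ b, v b ≠ 0 ∧ m = F.deg 0 b := by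
  rw [sum_smul_single F.ε, coeff_sum] at h
  obtain ⟨b, -, hb⟩ := Finset.exists_ne_zero_of_sum_ne_zero h
  rw [smul_eq_mul, scalarVec, coeff_C_mul] at hb
  exact ⟨b, left_ne_zero_of_mul hb,
    F.ε_homogeneous b m (mem_support_iff.2 (right_ne_zero_of_mul hb))⟩

variable {F}

/-- By exactness a kernel vector is a boundary, and by minimality boundaries have no constant terms.
-/
theorem scalarVec_eq_zero_of_ε_eq_zero {v : Fin (F.rank 0) → k} (h : F.ε (scalarVec v) = 0) :
    v = 0 := by
  obtain ⟨u, hu⟩ := (F.exact_ε _).1 h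
  ext b
  have := F.coeff_zero_d 0 u b
  rw [hu] at this
  simpa [scalarVec] using this

theorem scalarVec_eq_zero_of_d_eq_zero {j : ℕ} {v : Fin (F.rank (j + 1)) → k}
    (h : F.d j (scalarVec v) = 0) : v = 0 := by
  obtain ⟨u, hu⟩ := (F.exact_d j _).1 h
  ext b
  have := F.coeff_zero_d (j + 1) u b
  rw [hu] at this
  simpa [scalarVec] using this

theorem IsHomogeneousVec.contract {j : ℕ} {α β : σ →₀ ℕ} {v : Fin (F.rank (j + 1)) → k}
    (hv : F.IsHomogeneousVec (j + 1) α v) {p : σ} (hβ : Finsupp.single p 1 + β = α) :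
    F.IsHomogeneousVec j β (F.contract j p v) := by
  intro a ha
  obtain ⟨b, hb, h⟩ := F.exists_deg_of_coeff_d_ne_zero ha
  rw [hv b hb, ← hβ] at h
  exact add_left_cancel h

theorem IsHomogeneousVec.contract_eq_zero {j : ℕ} {α : σ →₀ ℕ} {v : Fin (F.rank (j + 1)) → k}
    (hv : F.IsHomogeneousVec (j + 1) α v) {p : σ} (hp : α p = 0) : F.contract j p v = 0 := by
  ext a
  by_contra ha
  obtain ⟨b, hb, h⟩ := F.exists_deg_of_coeff_d_ne_zero ha
  rw [hv b hb] at h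
  have := DFunLike.congr_fun h p
  simp [hp] at this

theorem isHomogeneousVec_zero {j : ℕ} {α : σ →₀ ℕ} : F.IsHomogeneousVec j α 0 :=
  fun _ h => absurd rfl h

theorem IsHomogeneousVec.smul {j : ℕ} {α : σ →₀ ℕ} {v : Fin (F.rank j) → k}
    (hv : F.IsHomogeneousVec j α v) (c : k) : F.IsHomogeneousVec j α (c • v) :=
  fun b hb => hv b (right_ne_zero_of_mul hb)

/-- The image is a single term of degree `α`; evaluating at all ones reads off its coefficient. -/
theorem IsHomogeneousVec.ε_eq {α : σ →₀ ℕ} {v : Fin (F.rank 0) → k}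
    (hv : F.IsHomogeneousVec 0 α v) : F.ε (scalarVec v) = monomial α (F.augment v) := by
  classical
  have h : F.ε (scalarVec v) = monomial α (coeff α (F.ε (scalarVec v))) := by
    ext m
    rw [coeff_monomial]
    split_ifs with h
    · rw [h]
    · by_contra hm
      obtain ⟨b, hb, hmb⟩ := F.exists_deg_of_coeff_ε_ne_zero hm
      exact h (by rw [hmb, hv b hb])
  have h2 : F.augment v = coeff α (F.ε (scalarVec v)) := by
    rw [augment, h, eval_monomial, coeff_monomial, if_pos rfl]
    simp [Finsupp.prod]
  rw [h2, ← h]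

theorem IsHomogeneousVec.augment_ne_zero {α : σ →₀ ℕ} {v : Fin (F.rank 0) → k}
    (hv : F.IsHomogeneousVec 0 α v) (hne : v ≠ 0) : F.augment v ≠ 0 := by
  intro h
  refine hne (scalarVec_eq_zero_of_ε_eq_zero ?_)
  rw [hv.ε_eq, h, monomial_zero]

theorem IsHomogeneousVec.monomial_mem {α : σ →₀ ℕ} {v : Fin (F.rank 0) → k}
    (hv : F.IsHomogeneousVec 0 α v) : monomial α (F.augment v) ∈ I := by
  have h : F.ε (scalarVec v) ∈ LinearMap.range F.ε := LinearMap.mem_range_self _ _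
  rwa [F.range_ε, hv.ε_eq] at h

theorem isHomogeneousVec_single (j : ℕ) (b : Fin (F.rank j)) :
    F.IsHomogeneousVec j (F.deg j b) (Pi.single b 1) := by
  intro a ha
  by_cases h : a = b
  · rw [h]
  · simp [h] at ha

variable {s : ℕ}

/-- If the elements of `I` have order at least `s`, the basis vectors of `F_j` have degree at least
`j + s`. -/
theorem le_degree_deg (hI : ∀ f ∈ I, ∀ m ∈ f.support, s ≤ m.degree) (j : ℕ) (b : Fin (F.rank j)) :
    j + s ≤ (F.deg j b).degree := by
  classical
  induction j with
  | zero =>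
    have hne : (Pi.single b 1 : Fin (F.rank 0) → k) ≠ 0 := by simp
    have hv := isHomogeneousVec_single (F := F) 0 b
    have := hI _ (hv.monomial_mem) (F.deg 0 b) (by
      rw [mem_support_iff, coeff_monomial, if_pos rfl]
      exact hv.augment_ne_zero hne)
    omega
  | succ j ih =>
    have hne : F.d j (scalarVec (Pi.single b 1)) ≠ 0 := fun h => by
      have := scalarVec_eq_zero_of_d_eq_zero h
      simp at this
    obtain ⟨a, ha⟩ := Function.ne_iff.1 hne
    obtain ⟨m, hm⟩ := ne_zero_iff.1 ha
    obtain ⟨b', hb', h⟩ := F.exists_deg_of_coeff_d_ne_zero hm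
    have hbb : b' = b := by
      by_contra h
      simp [h] at hb'
    rw [hbb] at h
    have hm0 : m.degree ≠ 0 := by
      intro h0
      rw [(Finsupp.degree_eq_zero_iff m).1 h0] at hm
      exact hm (F.coeff_zero_d _ _ _)
    rw [← h, map_add]
    have := ih a
    omega

section Fintype

variable [Fintype σ]

/-- Basis vectors of `F_j` have degree at least `j + s`, so the entries have degree at most one;
minimality excludes constants. -/
theorem IsHomogeneousVec.d_eq (hI : ∀ f ∈ I, ∀ m ∈ f.support, s ≤ m.degree) {j : ℕ} {α : σ →₀ ℕ}
    (hα : α.degree = j + 1 + s) {v : Fin (F.rank (j + 1)) → k}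
    (hv : F.IsHomogeneousVec (j + 1) α v) :
    F.d j (scalarVec v) = ∑ p, (X p : MvPolynomial σ k) • scalarVec (F.contract j p v) := by
  classical
  ext a m
  have hsum : coeff m ((∑ p, (X p : MvPolynomial σ k) • scalarVec (F.contract j p v)) a) =
      ∑ p, if Finsupp.single p 1 = m then F.contract j p v a else 0 := by
    rw [Finset.sum_apply, coeff_sum]
    refine Finset.sum_congr rfl fun p _ => ?_
    rw [Pi.smul_apply, smul_eq_mul, scalarVec, mul_comm, coeff_C_mul, coeff_X]
    simp
  rw [hsum]
  by_cases hm : ∃ p, Finsupp.single p 1 = m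
  · obtain ⟨p, rfl⟩ := hm
    rw [Finset.sum_eq_single p]
    · simp [MinimalMultigradedFreeResolution.contract]
    · intro q _ hqp
      rw [if_neg]
      intro h
      exact hqp (Finsupp.single_left_injective one_ne_zero h)
    · simp
  · rw [Finset.sum_eq_zero fun p _ => if_neg fun h => hm ⟨p, h⟩]
    by_contra hne
    obtain ⟨b, hb, h⟩ := F.exists_deg_of_coeff_d_ne_zero hne
    have h1 := F.le_degree_deg hI j a
    have h2 := congrArg Finsupp.degree h
    rw [hv b hb, map_add, hα] at h2
    have h0 : m.degree ≠ 0 := by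
      intro h0
      rw [(Finsupp.degree_eq_zero_iff m).1 h0] at hne
      exact hne (F.coeff_zero_d _ _ _)
    obtain ⟨p, hp⟩ := Finsupp.eq_single_of_degree_eq_one (m := m) (by omega)
    exact hm ⟨p, hp.symm⟩

theorem IsHomogeneousVec.exists_contract_ne_zero
    (hI : ∀ f ∈ I, ∀ m ∈ f.support, s ≤ m.degree) {j : ℕ} {α : σ →₀ ℕ}
    (hα : α.degree = j + 1 + s) {v : Fin (F.rank (j + 1)) → k}
    (hv : F.IsHomogeneousVec (j + 1) α v) (hne : v ≠ 0) : ∃ p, F.contract j p v ≠ 0 := by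
  by_contra! h
  refine hne (scalarVec_eq_zero_of_d_eq_zero (F := F) ?_)
  rw [hv.d_eq hI hα]
  simp [h, scalarVec_zero]

theorem IsHomogeneousVec.sum_augment_contract
    (hI : ∀ f ∈ I, ∀ m ∈ f.support, s ≤ m.degree) {α : σ →₀ ℕ}
    (hα : α.degree = 1 + s) {v : Fin (F.rank 1) → k}
    (hv : F.IsHomogeneousVec 1 α v) : ∑ p, F.augment (F.contract 0 p v) = 0 := by
  have h : F.ε (F.d 0 (scalarVec v)) = 0 := F.exact_ε.apply_apply_eq_zero _
  rw [hv.d_eq hI (by omega), map_sum] at h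
  have := congrArg (eval fun _ => (1 : k)) h
  simpa [augment] using this

theorem contract_contract
    (hI : ∀ f ∈ I, ∀ m ∈ f.support, s ≤ m.degree) {j : ℕ} {α : σ →₀ ℕ}
    (hα : α.degree = j + 2 + s) {v : Fin (F.rank (j + 2)) → k}
    (hv : F.IsHomogeneousVec (j + 2) α v) {p q : σ} (hpq : p ≠ q) :
    F.contract j p (F.contract (j + 1) q v) = -F.contract j q (F.contract (j + 1) p v) := by
  -- If `α q = 0` the contraction vanishes; otherwise it is homogeneous of degree one less, and
  -- `d_eq` applies again.
  have hD : ∀ q, F.d j (scalarVec (F.contract (j + 1) q v)) =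
      ∑ p, (X p : MvPolynomial σ k) • scalarVec (F.contract j p (F.contract (j + 1) q v)) := by
    intro q
    by_cases hq : α q = 0
    · rw [hv.contract_eq_zero hq]
      simp [contract_zero, scalarVec_zero]
    · obtain ⟨β, hβ⟩ : ∃ β, Finsupp.single q 1 + β = α :=
        ⟨α - Finsupp.single q 1, add_tsub_cancel_of_le (by
          rw [Finsupp.single_le_iff]; omega)⟩
      refine (hv.contract hβ).d_eq hI ?_
      rw [← hβ, map_add, Finsupp.degree_single] at hα
      omega
  have h : F.d j (F.d (j + 1) (scalarVec v)) = 0 := (F.exact_d j).apply_apply_eq_zero _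
  rw [hv.d_eq hI (by omega), map_sum] at h
  simp only [map_smul, hD] at h
  ext a
  have h2 := sum_X_mul_X_mul_C_eq_zero
    (w := fun q p => F.contract j p (F.contract (j + 1) q v) a) (by
      have := congrFun h a
      simpa [scalarVec, Finset.mul_sum, mul_assoc] using this) hpq.symm
  exact eq_neg_of_add_eq_zero_left h2

end Fintype

end MinimalMultigradedFreeResolution

namespace MinimalMultigradedFreeResolution

open MvPolynomial

variable {k σ : Type*} [Field k] {I : Ideal (MvPolynomial σ k)}
  {F : MinimalMultigradedFreeResolution I} {s : ℕ}

/-! ### The support of a vector in the linear strand -/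

/-- `F.Reaches j v C` says that the vector `v` of a squarefree multidegree `A ⊇ C` is not killed by
contracting with all the elements of `A \ C`. -/
def Reaches (F : MinimalMultigradedFreeResolution I) :
    (j : ℕ) → (Fin (F.rank j) → k) → Finset σ → Prop
  | 0, v, _ => v ≠ 0
  | j + 1, v, C => ∃ p ∉ C, F.Reaches j (F.contract j p v) C

theorem reaches_neg {j : ℕ} {v : Fin (F.rank j) → k} {C : Finset σ} (h : F.Reaches j v C) :
    F.Reaches j (-v) C := by
  induction j with
  | zero => exact neg_ne_zero.2 h
  | succ j ih =>
    obtain ⟨p, hp, h⟩ := h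
    exact ⟨p, hp, by rw [contract_neg]; exact ih h⟩

theorem ne_zero_of_reaches {j : ℕ} {v : Fin (F.rank j) → k} {C : Finset σ} (h : F.Reaches j v C) :
    v ≠ 0 := by
  induction j with
  | zero => exact h
  | succ j ih =>
    obtain ⟨p, hp, h⟩ := h
    rintro rfl
    exact ih h (F.contract_zero j p)

variable [DecidableEq σ]

theorem IsHomogeneousVec.contract_erase {j : ℕ} {A : Finset σ} {v : Fin (F.rank (j + 1)) → k}
    (hv : F.IsHomogeneousVec (j + 1) (squarefreeMultidegree A) v) {p : σ} (hp : p ∈ A) :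
    F.IsHomogeneousVec j (squarefreeMultidegree (A.erase p)) (F.contract j p v) :=
  hv.contract (single_add_squarefreeMultidegree_erase hp)

theorem IsHomogeneousVec.mem_of_contract_ne_zero {j : ℕ} {A : Finset σ}
    {v : Fin (F.rank (j + 1)) → k}
    (hv : F.IsHomogeneousVec (j + 1) (squarefreeMultidegree A) v) {p : σ}
    (h : F.contract j p v ≠ 0) : p ∈ A := by
  by_contra hp
  exact h (hv.contract_eq_zero (by rw [squarefreeMultidegree_apply, if_neg hp]))

theorem exists_homogeneous_of_reaches {j : ℕ} {A C : Finset σ} {v : Fin (F.rank j) → k}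
    (hv : F.IsHomogeneousVec j (squarefreeMultidegree A) v) (hA : A.card = j + s)
    (hCA : C ⊆ A) (hC : C.card = s) (h : F.Reaches j v C) :
    ∃ u : Fin (F.rank 0) → k, F.IsHomogeneousVec 0 (squarefreeMultidegree C) u ∧ u ≠ 0 := by
  induction j generalizing A with
  | zero =>
    obtain rfl := Finset.eq_of_subset_of_card_le hCA (by omega)
    exact ⟨v, hv, h⟩
  | succ j ih =>
    obtain ⟨p, hp, h⟩ := h
    have hpA := hv.mem_of_contract_ne_zero (ne_zero_of_reaches h)
    refine ih (hv.contract_erase hpA) ?_ (Finset.subset_erase.2 ⟨hCA, hp⟩) h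
    rw [Finset.card_erase_of_mem hpA]
    omega

variable [Fintype σ] (hI : ∀ f ∈ I, ∀ m ∈ f.support, s ≤ m.degree)

include hI

theorem exists_reaches {j : ℕ} {A : Finset σ} {v : Fin (F.rank j) → k}
    (hv : F.IsHomogeneousVec j (squarefreeMultidegree A) v) (hA : A.card = j + s) (hne : v ≠ 0) :
    ∃ C ⊆ A, C.card = s ∧ F.Reaches j v C := by
  induction j generalizing A with
  | zero => exact ⟨A, subset_rfl, by omega, hne⟩
  | succ j ih =>
    obtain ⟨p, hp⟩ := hv.exists_contract_ne_zero hI (by rwa [degree_squarefreeMultidegree]) hne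
    have hpA := hv.mem_of_contract_ne_zero hp
    obtain ⟨C, hCA, hC, h⟩ := ih (hv.contract_erase hpA)
      (by rw [Finset.card_erase_of_mem hpA]; omega) hp
    rw [Finset.subset_erase] at hCA
    exact ⟨C, hCA.1, hC, p, hCA.2, h⟩

/-- `Reaches` asks for only one order of contraction; since contractions anticommute, any order
works, so any `p ∈ A \ C` may come first. -/
theorem reaches_contract {j : ℕ} {A C : Finset σ} {v : Fin (F.rank (j + 1)) → k}
    (hv : F.IsHomogeneousVec (j + 1) (squarefreeMultidegree A) v) (hA : A.card = j + 1 + s)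
    (hCA : C ⊆ A) (hC : C.card = s) (h : F.Reaches (j + 1) v C) {p : σ} (hpA : p ∈ A)
    (hpC : p ∉ C) : F.Reaches j (F.contract j p v) C := by
  induction j generalizing A p with
  | zero =>
    obtain ⟨q, hq, h⟩ := h
    have hqA := hv.mem_of_contract_ne_zero (ne_zero_of_reaches h)
    have hcard : (A \ C).card ≤ 1 := by
      rw [Finset.card_sdiff_of_subset hCA]
      omega
    rw [Finset.card_le_one.1 hcard p (by simp [*]) q (by simp [*])]
    exact h
  | succ j ih =>
    obtain ⟨q, hq, h⟩ := h
    have hqA := hv.mem_of_contract_ne_zero (ne_zero_of_reaches h)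
    by_cases hpq : p = q
    · rwa [hpq]
    · have h1 := ih (hv.contract_erase hqA) (by rw [Finset.card_erase_of_mem hqA]; omega)
        (Finset.subset_erase.2 ⟨hCA, hq⟩) h (Finset.mem_erase.2 ⟨hpq, hpA⟩) hpC
      rw [contract_contract hI (by rw [degree_squarefreeMultidegree]; omega) hv hpq] at h1
      refine ⟨q, hq, ?_⟩
      have := reaches_neg h1
      rwa [neg_neg] at this

theorem reaches_exchange {j : ℕ} {A C : Finset σ} {v : Fin (F.rank j) → k}
    (hv : F.IsHomogeneousVec j (squarefreeMultidegree A) v) (hA : A.card = j + s)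
    (hCA : C ⊆ A) (hC : C.card = s) (h : F.Reaches j v C) {a : σ} (haA : a ∈ A) (haC : a ∉ C) :
    ∃ p ∈ C, F.Reaches j v ((insert a C).erase p) := by
  induction j generalizing A with
  | zero =>
    obtain rfl := Finset.eq_of_subset_of_card_le hCA (by omega)
    exact absurd haA haC
  | succ j ih =>
    -- Elements outside `C ∪ {a}` are contracted first, which reduces to a vector of `F_1` of degree
    -- `C ∪ {a}`.
    by_cases hb : ∃ b ∈ A, b ∉ insert a C
    · obtain ⟨b, hbA, hb⟩ := hb
      rw [Finset.mem_insert, not_or] at hb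
      obtain ⟨p, hp, h1⟩ := ih (hv.contract_erase hbA)
        (by rw [Finset.card_erase_of_mem hbA]; omega) (Finset.subset_erase.2 ⟨hCA, hb.2⟩)
        (reaches_contract hI hv hA hCA hC h hbA hb.2) (Finset.mem_erase.2 ⟨Ne.symm hb.1, haA⟩)
      refine ⟨p, hp, b, fun h => ?_, h1⟩
      simp [hb] at h
    · have hAC : A = insert a C := by
        refine Finset.Subset.antisymm (fun b hbA => ?_) (Finset.insert_subset haA hCA)
        by_contra h
        exact hb ⟨b, hbA, h⟩
      have hj : j = 0 := by
        have := congrArg Finset.card hAC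
        rw [Finset.card_insert_of_notMem haC] at this
        omega
      subst hj
      have h1 : F.contract 0 a v ≠ 0 := reaches_contract hI hv hA hCA hC h haA haC
      have h2 := (hv.contract_erase haA).augment_ne_zero h1
      have h3 := hv.sum_augment_contract hI (by rw [degree_squarefreeMultidegree]; omega)
      -- The augmented contractions sum to zero and the term at `a` is nonzero, so another term is
      -- too.
      obtain ⟨p, hpa, hp⟩ : ∃ p, p ≠ a ∧ F.augment (F.contract 0 p v) ≠ 0 := by
        by_contra! h4
        rw [Finset.sum_eq_single a (fun p _ hp => h4 p hp) (by simp)] at h3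
        exact h2 h3
      have hp0 : F.contract 0 p v ≠ 0 := fun h => hp (by rw [h, augment_zero])
      have hpA := hv.mem_of_contract_ne_zero hp0
      rw [hAC, Finset.mem_insert] at hpA
      exact ⟨p, hpA.resolve_left hpa, p, by simp, hp0⟩

end MinimalMultigradedFreeResolution

/-! ### Signs -/

section Sign

variable {P : Type*} (k : Type*) [Field k] (f : P → ℕ)

/-- The sign of `p` in `A` with respect to the order given by `f`. -/
def positionSign (A : Finset P) (p : P) : k := (-1) ^ (A.filter fun a => f a < f p).card

variable {k f}

theorem positionSign_ne_zero (A : Finset P) (p : P) : positionSign k f A p ≠ 0 :=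
  pow_ne_zero _ (neg_ne_zero.2 one_ne_zero)

/-- The simplicial sign rule: deleting the earlier element shifts the position of the later one by
one, but not conversely. -/
theorem positionSign_mul_add_eq_zero [DecidableEq P] (hf : Function.Injective f) {A : Finset P} {p q : P}
    (hp : p ∈ A) (hq : q ∈ A) (hpq : p ≠ q) :
    positionSign k f A p * positionSign k f (A.erase p) q +
      positionSign k f A q * positionSign k f (A.erase q) p = 0 := by
  wlog h : f p < f q generalizing p q
  · rw [add_comm]
    exact this hq hp hpq.symm (lt_of_le_of_ne (not_lt.1 h) fun h => hpq (hf h.symm))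
  have h1 : positionSign k f (A.erase q) p = positionSign k f A p := by
    unfold positionSign
    rw [Finset.filter_erase, Finset.erase_eq_of_notMem]
    simp [h.le]
  have h2 : positionSign k f A q = -positionSign k f (A.erase p) q := by
    unfold positionSign
    rw [Finset.filter_erase,
      ← Finset.card_erase_add_one (Finset.mem_filter.2 ⟨hp, h⟩), pow_succ]
    ring
  rw [h1, h2]
  ring

end Sign

theorem exists_injective_of_rank {P : Type*} [Finite P] (rk : P → ℕ) :
    ∃ f : P → ℕ, Function.Injective f ∧ ∀ p q, rk p < rk q → f p < f q := by
  obtain ⟨n, ⟨e⟩⟩ := Finite.exists_equiv_fin P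
  have hlt : ∀ p q, rk p < rk q → rk p * n + e p < rk q * n + e q := by
    intro p q h
    have h1 : (rk p + 1) * n ≤ rk q * n := Nat.mul_le_mul_right n h
    have h2 := (e p).2
    rw [Nat.add_mul, Nat.one_mul] at h1
    omega
  -- Lexicographic order by rank, then by an enumeration with values below `n`.
  refine ⟨fun p => rk p * n + e p, fun p q h => ?_, hlt⟩
  have h' : rk p * n + e p = rk q * n + e q := h
  rcases lt_trichotomy (rk p) (rk q) with h1 | h1 | h1
  · have := hlt p q h1
    omega
  · rw [h1] at h'
    exact e.injective (Fin.ext (by omega))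
  · have := hlt q p h1
    omega

/-! ### Subsets of complete multilevel sets and cancellation of signs -/

namespace IsCompleteMultilevel

variable {P : Type*} [PartialOrder P] {rk : P → ℕ} {s : ℕ} {A : Finset P} [Finite P]

omit [Finite P] in
theorem of_subset {B C : Finset P} (hA : IsCompleteMultilevel rk s A)
    (hC : IsCompleteMultilevel rk s C) (hCB : C ⊆ B) (hBA : B ⊆ A) :
    IsCompleteMultilevel rk s B where
  rank_le p hp := hA.rank_le p (hBA hp)
  exists_rank i h1 h2 := (hC.exists_rank i h1 h2).imp fun _ h => ⟨hCB h.1, h.2⟩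
  isMax p hp := hA.isMax p (hBA hp)
  lt p hp q hq := hA.lt p (hBA hp) q (hBA hq)

theorem exists_ne_rank_eq (hrk : IsPosetRankFunction rk) (hA : IsCompleteMultilevel rk s A)
    (hcard : s < A.card) : ∃ p ∈ A, ∃ q ∈ A, p ≠ q ∧ rk p = rk q :=
  Finset.exists_ne_map_eq_of_card_lt_of_maps_to (t := Finset.Icc 1 s) (by simpa using hcard)
    fun p hp => Finset.mem_coe.2 (Finset.mem_Icc.2 ⟨hrk.one_le p, hA.rank_le p hp⟩)

theorem injOn_of_card_eq (hrk : IsPosetRankFunction rk) (hA : IsCompleteMultilevel rk s A)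
    (hcard : A.card = s) : Set.InjOn rk A := by
  rw [← Finset.card_image_iff, hA.image_rank hrk]
  simp [hcard]

open scoped Classical in
/-- In a complete multilevel set with one superfluous element, the signs cancel. -/
theorem sum_positionSign {k : Type*} [Field k] [DecidableEq P] (hrk : IsPosetRankFunction rk) {f : P → ℕ}
    (hf : Function.Injective f) (hfr : ∀ p q, rk p < rk q → f p < f q)
    (hA : IsCompleteMultilevel rk s A) (hcard : A.card = s + 1) :
    ∑ p ∈ A, (if IsCompleteMultilevel rk s (A.erase p) then positionSign k f A p else 0) = 0 := by
  obtain ⟨p, hp, q, hq, hpq, hr⟩ := hA.exists_ne_rank_eq hrk (by omega)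
  wlog h : f p < f q generalizing p q
  · exact this q hq p hp hpq.symm hr.symm
      (lt_of_le_of_ne (not_lt.1 h) fun h => hpq (hf h.symm))
  -- A complete set of `s` elements has no repeated rank, so only the deletions of `p` and of `q`
  -- contribute.
  have hinj : ∀ x ∈ A, IsCompleteMultilevel rk s (A.erase x) → Set.InjOn rk (A.erase x) :=
    fun x hx h => h.injOn_of_card_eq hrk (by rw [Finset.card_erase_of_mem hx]; omega)
  have hAp := hA.erase hq hpq hr
  have hAq := hA.erase hp hpq.symm hr.symm
  have hsub : ({p, q} : Finset P) ⊆ A := by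
    simp [Finset.insert_subset_iff, hp, hq]
  rw [← Finset.sum_subset hsub, Finset.sum_pair hpq, if_pos hAp, if_pos hAq]
  · have hfil : A.filter (fun a => f a < f q) = insert p (A.filter fun a => f a < f p) := by
      ext a
      simp only [Finset.mem_filter, Finset.mem_insert]
      constructor
      · rintro ⟨ha, haq⟩
        by_cases hap : a = p
        · exact Or.inl hap
        · refine Or.inr ⟨ha, ?_⟩
          rcases lt_trichotomy (rk a) (rk p) with h1 | h1 | h1
          · exact hfr _ _ h1
          · have := hinj p hp hAp (by simp [ha, hap]) (by simp [hq, hpq.symm]) (h1.trans hr)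
            subst this
            omega
          · have := hfr q a (by omega)
            omega
      · rintro (rfl | ⟨ha, hap⟩)
        · exact ⟨hp, h⟩
        · exact ⟨ha, hap.trans h⟩
    unfold positionSign
    rw [hfil, Finset.card_insert_of_notMem (by simp), pow_succ]
    ring
  · intro x hx hxn
    rw [Finset.mem_insert, Finset.mem_singleton, not_or] at hxn
    rw [if_neg]
    intro h1
    exact hpq (hinj x hx h1 (by simp [hp, Ne.symm hxn.1]) (by simp [hq, Ne.symm hxn.2]) hr)

end IsCompleteMultilevel

/-- Off-diagonal terms cancel in pairs under swapping; the squares must vanish by themselves, also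
in characteristic 2. -/
theorem MvPolynomial.sum_X_mul_X_mul_C_of_alternating {k σ : Type*} [CommRing k] [Fintype σ]
    {w : σ → σ → k} (h0 : ∀ p, w p p = 0) (h : ∀ p q, p ≠ q → w p q + w q p = 0) :
    ∑ p, ∑ q, (MvPolynomial.X p * MvPolynomial.X q * MvPolynomial.C (w p q) :
      MvPolynomial σ k) = 0 := by
  rw [← Finset.sum_product']
  refine Finset.sum_involution (fun x _ => x.swap) (fun x _ => ?_) (fun x _ hx hsw => hx ?_)
    (fun _ _ => by simp) fun _ _ => by simp
  · by_cases hx : x.1 = x.2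
    · simp [hx, h0]
    · have := h x.1 x.2 hx
      simp only [Prod.fst_swap, Prod.snd_swap]
      rw [mul_comm (MvPolynomial.X x.2), ← mul_add, ← map_add, this, map_zero, mul_zero]
  · have : x.1 = x.2 := congrArg Prod.snd hsw
    simp [this, h0]

namespace MinimalMultigradedFreeResolution

open MvPolynomial

/-! ### Lifting to homogeneous scalar vectors -/

section Lift

variable {k σ : Type*} [Field k] {I : Ideal (MvPolynomial σ k)}
  {F : MinimalMultigradedFreeResolution I} {s : ℕ}

theorem exists_homogeneous_augment_eq_one (hI : ∀ f ∈ I, ∀ m ∈ f.support, s ≤ m.degree)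
    {α : σ →₀ ℕ} (hα : α.degree = s) (hmem : monomial α 1 ∈ I) :
    ∃ v, F.IsHomogeneousVec 0 α v ∧ F.augment v = 1 := by
  classical
  obtain ⟨u, hu⟩ : ∃ u, F.ε u = monomial α 1 := by
    rwa [← LinearMap.mem_range, F.range_ε]
  have hv : F.IsHomogeneousVec 0 α fun b => if F.deg 0 b = α then coeff 0 (u b) else 0 := by
    intro b hb
    by_contra h
    simp [h] at hb
  refine ⟨_, hv, ?_⟩
  have h1 := congrArg (coeff α) hv.ε_eq
  rw [coeff_monomial, if_pos rfl] at h1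
  rw [← h1]
  have h2 := congrArg (coeff α) hu
  rw [coeff_monomial, if_pos rfl] at h2
  rw [← h2, sum_smul_single F.ε, sum_smul_single F.ε, coeff_sum, coeff_sum]
  refine Finset.sum_congr rfl fun b _ => ?_
  rw [← scalarVec_single, (isHomogeneousVec_single 0 b).ε_eq, smul_eq_mul, smul_eq_mul,
    coeff_mul_monomial', coeff_mul_monomial']
  by_cases hb : F.deg 0 b ≤ α
  · have hb' : F.deg 0 b = α := by
      refine Finsupp.eq_of_le_of_degree_le hb ?_
      have := F.le_degree_deg hI 0 b
      omega
    simp [hb', scalarVec]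
  · simp [hb]

variable [Fintype σ]

/-- Linear coefficients of `d u` depend only on the constant coefficients of `u`, so it suffices to
keep those in degree `α`. -/
theorem exists_contract_eq {j : ℕ} {α : σ →₀ ℕ} {w : σ → Fin (F.rank j) → k}
    (hw : ∀ p β, Finsupp.single p 1 + β = α → F.IsHomogeneousVec j β (w p))
    (hw0 : ∀ p, α p = 0 → w p = 0)
    (hex : ∃ u, F.d j u = ∑ p, (X p : MvPolynomial σ k) • scalarVec (w p)) :
    ∃ v, F.IsHomogeneousVec (j + 1) α v ∧ ∀ p, F.contract j p v = w p := by
  classical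
  obtain ⟨u, hu⟩ := hex
  have h0 : ∀ p, F.contract j p (fun b => coeff 0 (u b)) = w p := by
    intro p
    ext a
    rw [← coeff_single_d, hu, Finset.sum_apply, coeff_sum, Finset.sum_eq_single p]
    · rw [Pi.smul_apply, smul_eq_mul, scalarVec, mul_comm, coeff_C_mul, coeff_X, if_pos rfl,
        mul_one]
    · intro q _ hqp
      rw [Pi.smul_apply, smul_eq_mul, scalarVec, mul_comm, coeff_C_mul, coeff_X, if_neg, mul_zero]
      intro h
      exact hqp (Finsupp.single_left_injective one_ne_zero h)
    · simp
  have hv : F.IsHomogeneousVec (j + 1) α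
      fun b => if F.deg (j + 1) b = α then coeff 0 (u b) else 0 := by
    intro b hb
    by_contra h
    simp [h] at hb
  refine ⟨_, hv, fun p => ?_⟩
  rw [← h0 p]
  ext a
  -- In such rows only coordinates of degree `α` contribute, so truncation is harmless; in all other
  -- rows both sides vanish.
  by_cases ha : Finsupp.single p 1 + F.deg j a = α
  · rw [← sub_eq_zero, ← Pi.sub_apply, ← contract_sub]
    by_contra hne
    obtain ⟨b, hb, h⟩ := F.exists_deg_of_coeff_d_ne_zero hne
    rw [ha] at h
    simp [← h] at hb
  · have h1 : F.contract j p
        (fun b => if F.deg (j + 1) b = α then coeff 0 (u b) else 0) a = 0 := by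
      by_contra hne
      obtain ⟨b, hb, h⟩ := F.exists_deg_of_coeff_d_ne_zero hne
      rw [hv b hb] at h
      exact ha h
    rw [h1, h0 p]
    by_contra hne
    by_cases hp : α p = 0
    · exact hne (by rw [hw0 p hp]; rfl)
    · have h2 : Finsupp.single p 1 + (α - Finsupp.single p 1) = α :=
        add_tsub_cancel_of_le (by rw [Finsupp.single_le_iff]; omega)
      exact ha (by rw [hw p _ h2 a (Ne.symm hne), h2])

end Lift

/-! ### Nonzero strand vectors for complete multilevel sets -/

section Family

variable {k P : Type*} [Field k] [PartialOrder P] [Fintype P] [DecidableEq P] {rk : P → ℕ} {s : ℕ}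
  {I : Ideal (MvPolynomial P k)} {F : MinimalMultigradedFreeResolution I}

/-- A choice of nonzero vectors in `F_j` of the multidegrees given by the complete multilevel sets
with `j + s` elements. -/
structure IsMultilevelFamily (F : MinimalMultigradedFreeResolution I) (rk : P → ℕ) (s j : ℕ)
    (v : Finset P → Fin (F.rank j) → k) : Prop where
  isHomogeneousVec : ∀ A, F.IsHomogeneousVec j (squarefreeMultidegree A) (v A)
  ne_zero : ∀ A, IsCompleteMultilevel rk s A → A.card = j + s → v A ≠ 0
  eq_zero : ∀ A, ¬ IsCompleteMultilevel rk s A → v A = 0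

/-- The candidate for the contractions of the vector of multidegree `A`. -/
def signedErase (f : P → ℕ) {n : ℕ} (v : Finset P → Fin n → k) (A : Finset P) (p : P) :
    Fin n → k :=
  if p ∈ A then positionSign k f A p • v (A.erase p) else 0

theorem IsMultilevelFamily.exists_succ (hrk : IsPosetRankFunction rk) (f : P → ℕ) {j : ℕ}
    {v : Finset P → Fin (F.rank j) → k} (hv : F.IsMultilevelFamily rk s j v)
    (hex : ∀ A, IsCompleteMultilevel rk s A → A.card = j + 1 + s →
      ∃ u, F.d j u = ∑ p, (X p : MvPolynomial P k) • scalarVec (signedErase f v A p)) :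
    ∃ v', F.IsMultilevelFamily rk s (j + 1) v' ∧
      ∀ A, IsCompleteMultilevel rk s A → A.card = j + 1 + s →
        ∀ p, F.contract j p (v' A) = signedErase f v A p := by
  have key : ∀ A, ∃ v', F.IsHomogeneousVec (j + 1) (squarefreeMultidegree A) v' ∧
      (IsCompleteMultilevel rk s A → A.card = j + 1 + s →
        ∀ p, F.contract j p v' = signedErase f v A p) ∧
      (¬ IsCompleteMultilevel rk s A → v' = 0) := by
    intro A
    by_cases hA : IsCompleteMultilevel rk s A ∧ A.card = j + 1 + s
    · have hhom : ∀ p β, Finsupp.single p 1 + β = squarefreeMultidegree A →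
          F.IsHomogeneousVec j β (signedErase f v A p) := by
        intro p β hβ
        unfold signedErase
        split_ifs with hp
        · rw [← single_add_squarefreeMultidegree_erase hp] at hβ
          rw [add_left_cancel hβ]
          exact (hv.isHomogeneousVec _).smul _
        · exact isHomogeneousVec_zero
      have hzero : ∀ p, squarefreeMultidegree A p = 0 → signedErase f v A p = 0 := by
        intro p hp
        rw [squarefreeMultidegree_apply] at hp
        exact if_neg fun h => by simp [h] at hp
      obtain ⟨v', h1, h2⟩ := exists_contract_eq hhom hzero (hex A hA.1 hA.2)
      exact ⟨v', h1, fun _ _ => h2, fun h => absurd hA.1 h⟩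
    · exact ⟨0, isHomogeneousVec_zero, fun h h' => absurd ⟨h, h'⟩ hA, fun _ => rfl⟩
  choose v' h1 h2 h3 using key
  refine ⟨v', ⟨h1, fun A hA hcard h0 => ?_, h3⟩, h2⟩
  -- Deleting one of two elements of equal rank leaves a complete set, whose vector is nonzero and
  -- is, up to sign, a contraction of `v' A`.
  obtain ⟨p, hp, q, hq, hpq, hr⟩ := hA.exists_ne_rank_eq hrk (by omega)
  have h4 := h2 A hA hcard p
  rw [h0, contract_zero, signedErase, if_pos hp] at h4
  refine hv.ne_zero (A.erase p) (hA.erase hq hpq hr) ?_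
    ((smul_eq_zero.1 h4.symm).resolve_left (positionSign_ne_zero A p))
  rw [Finset.card_erase_of_mem hp, hcard]
  omega

variable (hI : ∀ f ∈ I, ∀ m ∈ f.support, s ≤ m.degree)

include hI

omit [Fintype P] [DecidableEq P] in
theorem exists_multilevelFamily_zero
    (hmem : ∀ A : Finset P, IsCompleteMultilevel rk s A → A.card = s →
      monomial (squarefreeMultidegree A) (1 : k) ∈ I) :
    ∃ v, F.IsMultilevelFamily rk s 0 v ∧
      ∀ A, IsCompleteMultilevel rk s A → A.card = s → F.augment (v A) = 1 := by
  have key : ∀ A, ∃ v, F.IsHomogeneousVec 0 (squarefreeMultidegree A) v ∧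
      (IsCompleteMultilevel rk s A → A.card = s → F.augment v = 1) ∧
      (¬ IsCompleteMultilevel rk s A → v = 0) := by
    intro A
    by_cases hA : IsCompleteMultilevel rk s A ∧ A.card = s
    · obtain ⟨v, h1, h2⟩ := exists_homogeneous_augment_eq_one (F := F) hI
        (by rw [degree_squarefreeMultidegree, hA.2]) (hmem A hA.1 hA.2)
      exact ⟨v, h1, fun _ _ => h2, fun h => absurd hA.1 h⟩
    · exact ⟨0, isHomogeneousVec_zero, fun h h' => absurd ⟨h, h'⟩ hA, fun _ => rfl⟩
  choose v h1 h2 h3 using key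
  refine ⟨v, ⟨h1, fun A hA hcard h0 => ?_, h3⟩, h2⟩
  have := h2 A hA (by omega)
  rw [h0, augment_zero] at this
  exact zero_ne_one this

variable (hrk : IsPosetRankFunction rk) {f : P → ℕ} (hf : Function.Injective f)

include hf hrk

omit hI in
-- The prescribed element is killed by `ε`, because its image is the monomial of `A` times the sum
-- in `sum_positionSign`.
theorem IsMultilevelFamily.exists_preimage_zero (hfr : ∀ p q, rk p < rk q → f p < f q)
    {v : Finset P → Fin (F.rank 0) → k} (hv : F.IsMultilevelFamily rk s 0 v)
    (hone : ∀ A, IsCompleteMultilevel rk s A → A.card = s → F.augment (v A) = 1)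
    {A : Finset P} (hA : IsCompleteMultilevel rk s A) (hcard : A.card = 1 + s) :
    ∃ u, F.d 0 u = ∑ p, (X p : MvPolynomial P k) • scalarVec (signedErase f v A p) := by
  classical
  refine (F.exact_ε _).1 ?_
  rw [map_sum]
  have hterm : ∀ p ∈ A, F.ε ((X p : MvPolynomial P k) • scalarVec (signedErase f v A p)) =
      monomial (squarefreeMultidegree A)
        (if IsCompleteMultilevel rk s (A.erase p) then positionSign k f A p else 0) := by
    intro p hp
    rw [map_smul, signedErase, if_pos hp,
      ((hv.isHomogeneousVec (A.erase p)).smul (positionSign k f A p)).ε_eq, augment_smul,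
      smul_eq_mul, X, monomial_mul, single_add_squarefreeMultidegree_erase hp, one_mul]
    congr 1
    split_ifs with h
    · rw [hone _ h (by rw [Finset.card_erase_of_mem hp]; omega), mul_one]
    · rw [hv.eq_zero _ h, augment_zero, mul_zero]
  rw [← Finset.sum_subset (Finset.subset_univ A), Finset.sum_congr rfl hterm, ← map_sum,
    hA.sum_positionSign hrk hf hfr (by omega), monomial_zero]
  intro p _ hp
  simp [signedErase, hp, scalarVec_zero]

omit hrk in
theorem IsMultilevelFamily.exists_preimage_succ {j : ℕ}
    {v : Finset P → Fin (F.rank j) → k} (hv : F.IsMultilevelFamily rk s j v)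
    {v' : Finset P → Fin (F.rank (j + 1)) → k} (hv' : F.IsMultilevelFamily rk s (j + 1) v')
    (hc : ∀ A, IsCompleteMultilevel rk s A → A.card = j + 1 + s →
      ∀ p, F.contract j p (v' A) = signedErase f v A p)
    {A : Finset P} (hA : IsCompleteMultilevel rk s A) (hcard : A.card = j + 1 + 1 + s) :
    ∃ u, F.d (j + 1) u = ∑ p, (X p : MvPolynomial P k) • scalarVec (signedErase f v' A p) := by
  have hcontr : ∀ p ∈ A, ∀ q ∈ A, p ≠ q → F.contract j q (v' (A.erase p)) =
      positionSign k f (A.erase p) q • v ((A.erase p).erase q) := by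
    intro p hp q hq hpq
    by_cases h : IsCompleteMultilevel rk s (A.erase p)
    · rw [hc _ h (by rw [Finset.card_erase_of_mem hp]; omega), signedErase,
        if_pos (by simp [hq, hpq.symm])]
    · rw [hv'.eq_zero _ h, contract_zero, hv.eq_zero, smul_zero]
      -- If `A \ {p, q}` were complete, so would be `A \ p`, lying between it and `A`; so both sides
      -- are zero.
      exact fun h' => h (hA.of_subset h' (Finset.erase_subset _ _) (Finset.erase_subset _ _))
  have hnotMem : ∀ p q, q ∉ A.erase p → F.contract j q (signedErase f v' A p) = 0 := by
    intro p q hq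
    unfold signedErase
    split_ifs
    · rw [contract_smul, (hv'.isHomogeneousVec _).contract_eq_zero
        (by rw [squarefreeMultidegree_apply, if_neg hq]), smul_zero]
    · exact F.contract_zero j q
  have hd : ∀ p, F.d j ((X p : MvPolynomial P k) • scalarVec (signedErase f v' A p)) =
      ∑ q, (X p * X q : MvPolynomial P k) •
        scalarVec (F.contract j q (signedErase f v' A p)) := by
    intro p
    by_cases hp : p ∈ A
    · have hh : F.IsHomogeneousVec (j + 1) (squarefreeMultidegree (A.erase p))
          (signedErase f v' A p) := by
        rw [signedErase, if_pos hp]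
        exact (hv'.isHomogeneousVec _).smul _
      rw [map_smul, hh.d_eq hI, Finset.smul_sum]
      · simp only [mul_smul]
      · rw [degree_squarefreeMultidegree, Finset.card_erase_of_mem hp]
        omega
    · simp [signedErase, hp, contract_zero, scalarVec_zero]
  refine (F.exact_d j _).1 ?_
  rw [map_sum, Finset.sum_congr rfl fun p _ => hd p]
  ext1 a
  have halt := sum_X_mul_X_mul_C_of_alternating (k := k)
    (w := fun p q => F.contract j q (signedErase f v' A p) a)
    (fun p => by rw [hnotMem p p (by simp)]; rfl) fun p q hpq => ?_
  · simpa [scalarVec] using halt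
  · by_cases hp : p ∈ A
    · by_cases hq : q ∈ A
      · simp only [signedErase, if_pos hp, if_pos hq]
        rw [contract_smul, contract_smul, hcontr p hp q hq hpq, hcontr q hq p hp hpq.symm,
          smul_smul, smul_smul, Finset.erase_right_comm (a := q) (b := p), Pi.smul_apply,
          Pi.smul_apply, ← add_smul, positionSign_mul_add_eq_zero hf hp hq hpq, zero_smul]
      · rw [hnotMem p q (fun h => hq (Finset.mem_of_mem_erase h))]
        simp [signedErase, hq, contract_zero]
    · rw [hnotMem q p (fun h => hp (Finset.mem_of_mem_erase h))]
      simp [signedErase, hp, contract_zero]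

omit hf in
theorem exists_multilevelFamily
    (hmem : ∀ A : Finset P, IsCompleteMultilevel rk s A → A.card = s →
      monomial (squarefreeMultidegree A) (1 : k) ∈ I) (j : ℕ) :
    ∃ v, F.IsMultilevelFamily rk s j v := by
  obtain ⟨f, hf, hfr⟩ := exists_injective_of_rank rk
  -- Two consecutive families are carried along, since the cycle condition at the next stage needs
  -- the contractions of `v'` in terms of `v`.
  have key : ∃ v v', F.IsMultilevelFamily rk s j v ∧ F.IsMultilevelFamily rk s (j + 1) v' ∧
      ∀ A, IsCompleteMultilevel rk s A → A.card = j + 1 + s →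
        ∀ p, F.contract j p (v' A) = signedErase f v A p := by
    induction j with
    | zero =>
      obtain ⟨v, hv, hone⟩ := exists_multilevelFamily_zero (F := F) hI hmem
      obtain ⟨v', hv', hc⟩ := hv.exists_succ hrk f fun A hA hcard =>
        hv.exists_preimage_zero hrk hf hfr hone hA (by omega)
      exact ⟨v, v', hv, hv', hc⟩
    | succ j ih =>
      obtain ⟨v, v', hv, hv', hc⟩ := ih
      obtain ⟨v'', hv'', hc'⟩ := hv'.exists_succ hrk f fun A hA hcard =>
        hv.exists_preimage_succ hI hf hv' hc hA hcard
      exact ⟨v', v'', hv', hv'', hc'⟩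
  obtain ⟨v, -, hv, -⟩ := key
  exact ⟨v, hv⟩

end Family

end MinimalMultigradedFreeResolution

theorem mainTheorem5 {k : Type*} [Field k] {P : Type*} [PartialOrder P] [Fintype P]
    (rk : P → ℕ) (hrk : IsPosetRankFunction rk)
    (s : ℕ) (hs : IsLeast (rk '' {p : P | IsMax p}) s)
    (F : MinimalMultigradedFreeResolution (flagIdeal k P)) (A : Finset P) :
    F.AppearsInLinearStrand s (squarefreeMultidegree A) ↔
      ((∀ p ∈ A, 1 ≤ rk p ∧ rk p ≤ s) ∧ level rk A s ⊆ {p : P | IsMax p}) ∧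
      (∀ i, 1 ≤ i → i ≤ s → (level rk A i).Nonempty) ∧
      (∀ i, 1 ≤ i → i + 1 ≤ s →
        IsCompleteBipartiteSubposet (nonmaxLevel rk A i) (level rk A (i + 1))) := by
  classical
  rw [← isCompleteMultilevel_iff hrk hs]
  obtain ⟨p₀, hp₀, hps⟩ := hs.1
  have : Nonempty P := ⟨p₀⟩
  have hs1 : 1 ≤ s := hps ▸ hrk.one_le p₀
  have hchain : ∀ C : Finset P, IsMaxChain (· ≤ ·) (C : Set P) → s ≤ C.card := by
    intro C hC
    obtain ⟨t, -, htm, ht, -⟩ := hrk.maxChain_spec hC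
    exact ht ▸ hs.2 ⟨t, htm, rfl⟩
  have hI : ∀ f ∈ flagIdeal k P, ∀ m ∈ f.support, s ≤ m.degree := by
    intro f hf m hm
    obtain ⟨C, hC, hCm⟩ := mem_flagIdeal_iff.1 hf m hm
    have := Finsupp.degree_le_degree_of_le hCm
    rw [degree_squarefreeMultidegree] at this
    exact (hchain C hC).trans this
  unfold MinimalMultigradedFreeResolution.AppearsInLinearStrand
  simp only [degree_squarefreeMultidegree, MinimalMultigradedFreeResolution.betti]
  constructor
  · rintro ⟨j, hcard, hb⟩
    obtain ⟨⟨b, hb⟩⟩ := (Nat.card_ne_zero.1 hb).1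
    have hv : F.IsHomogeneousVec j (squarefreeMultidegree A) (Pi.single b 1) :=
      hb ▸ MinimalMultigradedFreeResolution.isHomogeneousVec_single j b
    refine isCompleteMultilevel_of_exchange hrk
      (S := fun C => C ⊆ A ∧ C.card = s ∧ F.Reaches j (Pi.single b 1) C) ?_ ?_ ?_
    · rintro C ⟨hCA, hC, h⟩
      refine ⟨hCA, hC, ?_⟩
      obtain ⟨u, hu, hne⟩ :=
        MinimalMultigradedFreeResolution.exists_homogeneous_of_reaches hv hcard hCA hC h
      obtain ⟨C', hC', hle⟩ := mem_flagIdeal_iff.1 hu.monomial_mem (squarefreeMultidegree C) (by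
        rw [MvPolynomial.mem_support_iff, MvPolynomial.coeff_monomial, if_pos rfl]
        exact hu.augment_ne_zero hne)
      -- The monomial of `C` lies in the ideal, so `C` contains a maximal chain; that has at least
      -- `s = |C|` elements, hence equals `C`.
      rwa [← Finset.eq_of_subset_of_card_le (squarefreeMultidegree_le_iff.1 hle)
        (hC ▸ hchain C' hC')]
    · rintro C ⟨hCA, hC, h⟩ a haA haC
      obtain ⟨p, hp, h'⟩ :=
        MinimalMultigradedFreeResolution.reaches_exchange hI hv hcard hCA hC h haA haC
      refine ⟨p, hp, (Finset.erase_subset _ _).trans (Finset.insert_subset haA hCA), ?_, h'⟩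
      rw [Finset.card_erase_of_mem (Finset.mem_insert_of_mem hp),
        Finset.card_insert_of_notMem haC, hC, Nat.add_sub_cancel]
    · exact MinimalMultigradedFreeResolution.exists_reaches hI hv hcard (by simp)
  · intro hA
    have hle : s ≤ A.card := by
      have := Finset.card_image_le (s := A) (f := rk)
      rwa [hA.image_rank hrk, Nat.card_Icc, Nat.add_sub_cancel] at this
    obtain ⟨j, hj⟩ := Nat.exists_eq_add_of_le' hle
    obtain ⟨v, hv⟩ := MinimalMultigradedFreeResolution.exists_multilevelFamily (F := F) hI hrk
      (fun C hC hcard => mem_flagIdeal_iff.2 fun m hm => by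
        rw [MvPolynomial.mem_support_iff, MvPolynomial.coeff_monomial] at hm
        obtain rfl : squarefreeMultidegree C = m := by
          by_contra h
          exact hm (if_neg h)
        exact ⟨C, hC.isMaxChain hrk hs1 hcard, le_rfl⟩) j
    obtain ⟨b, hb⟩ := Function.ne_iff.1 (hv.ne_zero A hA hj)
    exact ⟨j, hj, Nat.card_ne_zero.2 ⟨⟨b, hv.isHomogeneousVec A b hb⟩, inferInstance⟩⟩
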